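/- Let $k$ be a field, $S=k[x_1,\dots,x_n]$ a standard graded polynomial ring, and $I\subset S$ an ideal generated by square-free monomials of degree $3$ ($I=0$ is allowed). Call $I$ linearly presented if $\mathrm{Tor}_0^S(I,k)_e=0$ for all $e\neq 3$ and $\mathrm{Tor}_1^S(I,k)_e=0$ for all $e\neq 4$. For a set $K$ of variables, let $I_K\subset k[K]$ be the restriction of $I$ to $K$, that is, the ideal obtained from $I$ by setting the variables outside $K$ to zero. The dual graph $G(J)$ of a monomial ideal $J$ has the minimal monomial generators of $J$ as vertices, and $f,g$ are adjacent if and only if $\deg\gcd(f,g)=\deg f-1=\deg g-1$. It is called disconnected if it has two vertices that are not joined by a path. Then $I$ is linearly presented if and only if there is no set $K$ of at most $6$ variables such that $G(I_K)$ is disconnected and, up to relabeling of the variables (an injection of $K$ into $\{x_1,\dots,x_6\}$), the set of minimal monomial generators of $I_K$ is a subset of 1. $\{x_1x_2x_3,\ x_4x_5x_6\}$, or 2. $\{x_1x_2x_3,\ x_1x_2x_4,\ x_1x_2x_5,\ x_3x_4x_5\}$. -/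

import Mathlib

open MvPolynomial

universe u

noncomputable section

namespace CubicLinear

section Resolution

variable {k : Type u} [Field k] {n : ℕ}

/-- The homogeneous maximal ideal `(x₁, …, xₙ)` of `S = k[x₁, …, xₙ]`. -/
def maxIdeal (k : Type u) [Field k] (n : ℕ) : Ideal (MvPolynomial (Fin n) k) :=
  Ideal.span (Set.range X)

/-- In the graded free module `⨁ i, S(-deg i)`, the vector `x` is homogeneous of degree `e`:
its nonzero `i`-th coordinate is a form of degree `e - deg i`. -/
def IsHomogeneousVec {ι : Type u} (deg : ι → ℕ) (e : ℕ)
    (x : ι →₀ MvPolynomial (Fin n) k) : Prop :=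
  ∀ i, x i ≠ 0 → ∃ m : ℕ, deg i + m = e ∧ (x i).IsHomogeneous m

/-- A graded free resolution `⋯ → F₂ → F₁ → F₀ → I → 0` of an ideal `I` of `S`, where
`F s = ⨁ j : ι s, S(-deg s j)` and all maps are homogeneous of degree `0`. -/
structure GradedFreeResolution (I : Ideal (MvPolynomial (Fin n) k)) where
  /-- index set of the chosen homogeneous basis of `F s` -/
  ι : ℕ → Type u
  /-- degrees of the basis elements -/
  deg : (s : ℕ) → ι s → ℕ
  /-- the differential `F (s + 1) → F s` -/
  d : (s : ℕ) → (ι (s + 1) →₀ MvPolynomial (Fin n) k) →ₗ[MvPolynomial (Fin n) k]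
    (ι s →₀ MvPolynomial (Fin n) k)
  /-- the augmentation `F 0 → I ⊆ S` -/
  ε : (ι 0 →₀ MvPolynomial (Fin n) k) →ₗ[MvPolynomial (Fin n) k] MvPolynomial (Fin n) k
  d_homogeneous : ∀ (s : ℕ) (j : ι (s + 1)),
    IsHomogeneousVec (deg s) (deg (s + 1) j) (d s (Finsupp.single j 1))
  ε_homogeneous : ∀ j : ι 0, (ε (Finsupp.single j 1)).IsHomogeneous (deg 0 j)
  range_ε : LinearMap.range ε = I
  exact_zero : LinearMap.ker ε = LinearMap.range (d 0)
  exact_succ : ∀ s : ℕ, LinearMap.ker (d s) = LinearMap.range (d (s + 1))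

namespace GradedFreeResolution

variable {I : Ideal (MvPolynomial (Fin n) k)}

/-- The preimage in `F s` of the `s`-cycles of `F ⊗ k = F / 𝔪F`. -/
def cycles (F : GradedFreeResolution I) :
    (s : ℕ) → Submodule (MvPolynomial (Fin n) k) (F.ι s →₀ MvPolynomial (Fin n) k)
  | 0 => ⊤
  | s + 1 => Submodule.comap (F.d s) (maxIdeal k n • ⊤)

/-- The preimage in `F s` of the `s`-boundaries of `F ⊗ k = F / 𝔪F`. -/
def boundaries (F : GradedFreeResolution I) (s : ℕ) :
    Submodule (MvPolynomial (Fin n) k) (F.ι s →₀ MvPolynomial (Fin n) k) :=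
  LinearMap.range (F.d s) ⊔ maxIdeal k n • ⊤

/-- `Tor_s^S(I, k)_e = 0`, where `Tor_s^S(I, k)` is the homology `cycles / boundaries`
of `F ⊗ k` at the place `s`: each cycle of degree `e` is a boundary. -/
def TorVanishes (F : GradedFreeResolution I) (s e : ℕ) : Prop :=
  ∀ x ∈ F.cycles s, IsHomogeneousVec (F.deg s) e x → x ∈ F.boundaries s

end GradedFreeResolution

/-- The condition `N_{d,p}`: for all `s ≤ p - 1` the graded vector space `Tor_s^S(I, k)` is
concentrated in degree `d + s`. Since `Tor` does not depend on the resolution, it may be computed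
from any graded free resolution of `I`. (So `N_{d,1}` says that `I` is generated in degree `d`.) -/
def SatisfiesN (I : Ideal (MvPolynomial (Fin n) k)) (d p : ℕ) : Prop :=
  ∃ F : GradedFreeResolution I, ∀ s < p, ∀ e : ℕ, e ≠ d + s → F.TorVanishes s e

/-- An ideal generated in degree `d` is linearly presented if it satisfies `N_{d,2}`. -/
def IsLinearlyPresented (I : Ideal (MvPolynomial (Fin n) k)) (d : ℕ) : Prop :=
  SatisfiesN I d 2

end Resolution

section Monomial

variable {k : Type u} [Field k] {σ : Type*}

/-- `I` is generated by square-free monomials of degree `d` (the zero ideal is allowed). -/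
def IsSquarefreeMonomialIdeal (I : Ideal (MvPolynomial σ k)) (d : ℕ) : Prop :=
  ∃ H : Set (Finset σ), (∀ A ∈ H, A.card = d) ∧
    I = Ideal.span ((fun A : Finset σ => ∏ i ∈ A, (X i : MvPolynomial σ k)) '' H)

/-- The exponent vectors of the minimal monomial generators of a monomial ideal: the monomials
in `I` that are minimal with respect to divisibility. -/
def minGens (I : Ideal (MvPolynomial σ k)) : Set (σ →₀ ℕ) :=
  {a | Minimal (fun b : σ →₀ ℕ => monomial b (1 : k) ∈ I) a}

/-- The dual graph `G(I)`: the vertices are the minimal monomial generators, and `f`, `g` are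
adjacent if and only if `|gcd(f, g)| = |f| - 1 = |g| - 1`. The gcd of two monomials has as
exponent vector the pointwise minimum. -/
def dualGraph (I : Ideal (MvPolynomial σ k)) : SimpleGraph (minGens I) where
  Adj f g := (f.1 ⊓ g.1).degree + 1 = f.1.degree ∧ (f.1 ⊓ g.1).degree + 1 = g.1.degree
  symm := ⟨fun f g h => by rw [inf_comm]; exact ⟨h.2, h.1⟩⟩
  loopless := ⟨fun f h => by simp at h⟩

/-- `G(I)` is disconnected: two of its vertices are not joined by a path. (In particular the empty
graph is not disconnected.) -/
def IsDisconnected (I : Ideal (MvPolynomial σ k)) : Prop :=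
  ¬ (dualGraph I).Preconnected

open Classical in
/-- The restriction `I_K` to the variables in `K`: the ideal of `k[K]` obtained from `I` by setting
the variables outside `K` to zero. -/
def restriction (I : Ideal (MvPolynomial σ k)) (K : Finset σ) : Ideal (MvPolynomial K k) :=
  I.map (aeval (fun i : σ => if h : i ∈ K then (X ⟨i, h⟩ : MvPolynomial K k) else 0) :
    MvPolynomial σ k →ₐ[k] MvPolynomial K k)

end Monomial

/-- The exponent vector of the square-free monomial with support `A`. -/
def sqfree (A : Finset (Fin 6)) : Fin 6 →₀ ℕ := ∑ i ∈ A, Finsupp.single i 1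

/-- `{x₁x₂x₃, x₄x₅x₆}`; the variable `xᵢ` has index `i - 1`. -/
def patternOne : Set (Fin 6 →₀ ℕ) := {sqfree {0, 1, 2}, sqfree {3, 4, 5}}

/-- `{x₁x₂x₃, x₁x₂x₄, x₁x₂x₅, x₃x₄x₅}`; the variable `xᵢ` has index `i - 1`. -/
def patternTwo : Set (Fin 6 →₀ ℕ) :=
  {sqfree {0, 1, 2}, sqfree {0, 1, 3}, sqfree {0, 1, 4}, sqfree {2, 3, 4}}

/-- After the relabeling `e` of the variables as some of `x₁, …, x₆`, the minimal monomial
generators of `J` all lie in `P`. -/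
def IsSubsetUpToRelabeling {k : Type u} [Field k] {τ : Type*} (J : Ideal (MvPolynomial τ k))
    (P : Set (Fin 6 →₀ ℕ)) : Prop :=
  ∃ e : τ ↪ Fin 6, Finsupp.mapDomain e '' minGens J ⊆ P

end CubicLinear

end

/-! Write `H` for the family of triples that generates `I`, and call two triples adjacent if they
share two elements. Both directions pass through a statement about paths: `I` is linearly presented
if and only if any two triples `A`, `B` in `H` are joined by a path of triples of `H` inside `A ∪
B`.

Paths give linearity (`ker_augmentation_le`): the relations among monomials are spanned by
differences of two terms of the same multidegree. Along a path such a difference telescopes into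
multiples of relations of degree 4. A presentation with these relations extends to a graded free
resolution, and its degrees force the required `Tor` to vanish.

Linearity gives paths, and in fact `Linked H K` for every `K` (`linked_of_isLinearlyPresented`): for
a minimal counterexample `K`, two unjoined triples give a relation of degree `|K| > 4`. By
`mem_maxIdeal_smul_ker` it lies in `𝔪` times the relations. The coefficient at `K` of the part of
the augmentation coming from one component vanishes there, yet equals 1 on the relation.

The reduction to the two patterns is combinatorial (`path_of_no_obstruction`). Without a path, `A ∪
B` has five or six elements. With five, one of the two triples has its complement contained in every
other triple, which is pattern two. With six, a third triple would connect `A` and `B` through the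
smaller cases, so there are only two triples, which is pattern one. -/

noncomputable section

namespace CubicLinear

/-! ### Homogeneous vectors and their components in graded free modules. -/

section Graded

variable {k : Type u} [Field k] {n : ℕ} {ι κ : Type u}

theorem isHomogeneousVec_zero (deg : ι → ℕ) (e : ℕ) :
    IsHomogeneousVec deg e (0 : ι →₀ MvPolynomial (Fin n) k) := fun _ h => absurd rfl h

theorem IsHomogeneousVec.add {deg : ι → ℕ} {e : ℕ} {x y : ι →₀ MvPolynomial (Fin n) k}
    (hx : IsHomogeneousVec deg e x) (hy : IsHomogeneousVec deg e y) :
    IsHomogeneousVec deg e (x + y) := by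
  intro i hi
  by_cases h : x i = 0
  · rw [Finsupp.add_apply, h, zero_add] at hi ⊢
    exact hy i hi
  · obtain ⟨m, hm, hm'⟩ := hx i h
    refine ⟨m, hm, hm'.add ?_⟩
    by_cases h2 : y i = 0
    · rw [h2]; exact isHomogeneous_zero _ _ _
    · obtain ⟨m', hm2, hm2'⟩ := hy i h2
      obtain rfl : m = m' := by omega
      exact hm2'

theorem IsHomogeneousVec.neg {deg : ι → ℕ} {e : ℕ} {x : ι →₀ MvPolynomial (Fin n) k}
    (hx : IsHomogeneousVec deg e x) : IsHomogeneousVec deg e (-x) := by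
  intro i hi
  obtain ⟨m, hm, hm'⟩ := hx i (by simpa using hi)
  exact ⟨m, hm, hm'.neg⟩

theorem IsHomogeneousVec.smul {deg : ι → ℕ} {e d : ℕ} {x : ι →₀ MvPolynomial (Fin n) k}
    {p : MvPolynomial (Fin n) k} (hp : p.IsHomogeneous d) (hx : IsHomogeneousVec deg e x) :
    IsHomogeneousVec deg (d + e) (p • x) := by
  intro i hi
  obtain ⟨m, hm, hm'⟩ := hx i (by rintro h; simp [h] at hi)
  exact ⟨d + m, by omega, hp.mul hm'⟩

theorem isHomogeneousVec_single_one (deg : ι → ℕ) (j : ι) :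
    IsHomogeneousVec deg (deg j) (Finsupp.single j (1 : MvPolynomial (Fin n) k)) := by
  intro i hi
  obtain rfl : j = i := by
    by_contra h
    simp [h] at hi
  exact ⟨0, rfl, by simpa using isHomogeneous_one _ _⟩

/-- The component of degree `e` of a vector in the graded free module `⨁ i, S(-deg i)`. -/
def gradedComponent (deg : ι → ℕ) (e : ℕ) :
    (ι →₀ MvPolynomial (Fin n) k) →ₗ[k] (ι →₀ MvPolynomial (Fin n) k) :=
  Finsupp.lsum k fun i => Finsupp.lsingle i ∘ₗ
    (if deg i ≤ e then homogeneousComponent (e - deg i) else 0)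

theorem gradedComponent_apply (deg : ι → ℕ) (e : ℕ) (x : ι →₀ MvPolynomial (Fin n) k) (i : ι) :
    gradedComponent deg e x i =
      if deg i ≤ e then homogeneousComponent (e - deg i) (x i) else 0 := by
  induction x using Finsupp.induction_linear with
  | zero => simp
  | add x y hx hy =>
    rw [map_add, Finsupp.add_apply, hx, hy]
    split_ifs <;> simp
  | single j p =>
    by_cases h : j = i
    · subst h
      simp only [gradedComponent, Finsupp.lsum_single, LinearMap.comp_apply,
        Finsupp.lsingle_apply, Finsupp.single_eq_same]
      split_ifs <;> simp
    · simp [gradedComponent, h]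

theorem isHomogeneousVec_gradedComponent (deg : ι → ℕ) (e : ℕ)
    (x : ι →₀ MvPolynomial (Fin n) k) : IsHomogeneousVec deg e (gradedComponent deg e x) := by
  intro i hi
  rw [gradedComponent_apply] at hi ⊢
  split_ifs at hi ⊢ with h
  · exact ⟨e - deg i, by omega, homogeneousComponent_isHomogeneous _ _⟩
  · exact absurd rfl hi

theorem IsHomogeneousVec.gradedComponent_eq {deg : ι → ℕ} {d : ℕ}
    {x : ι →₀ MvPolynomial (Fin n) k} (hx : IsHomogeneousVec deg d x) (e : ℕ) :
    gradedComponent deg e x = if d = e then x else 0 := by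
  ext1 i
  rw [gradedComponent_apply]
  by_cases h : x i = 0
  · split_ifs <;> simp [h]
  · obtain ⟨m, rfl, hm⟩ := hx i h
    by_cases he : deg i ≤ e
    · rw [if_pos he, homogeneousComponent_of_mem hm]
      by_cases h' : e - deg i = m
      · rw [if_pos h', if_pos (by omega)]
      · rw [if_neg h', if_neg (by omega)]; rfl
    · rw [if_neg he, if_neg (by omega)]; rfl

theorem exists_sum_gradedComponent (deg : ι → ℕ) (x : ι →₀ MvPolynomial (Fin n) k) :
    ∃ s : Finset ℕ, x = ∑ e ∈ s, gradedComponent deg e x := by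
  -- The supremum bounds the degree of every term of every coordinate, so no component beyond it is
  -- nonzero.
  refine ⟨Finset.range (x.support.sup (fun i => deg i + (x i).totalDegree) + 1), ?_⟩
  ext1 i
  rw [Finsupp.finsetSum_apply]
  simp only [gradedComponent_apply]
  by_cases h : x i = 0
  · simp [h]
  have hle : deg i + (x i).totalDegree ≤ x.support.sup (fun i => deg i + (x i).totalDegree) :=
    Finset.le_sup (f := fun i => deg i + (x i).totalDegree) (by simpa using h)
  generalize x.support.sup (fun i => deg i + (x i).totalDegree) = N at hle
  conv_lhs => rw [← sum_homogeneousComponent (x i)]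
  rw [← Finset.sum_filter]
  symm
  -- Shifting by `deg i` turns degrees of the polynomial `x i` into degrees of the vector; the
  -- remaining degrees contribute zero.
  have hsub : (Finset.range ((x i).totalDegree + 1)).map (addRightEmbedding (deg i)) ⊆
      {e ∈ Finset.range (N + 1) | deg i ≤ e} := by
    intro e he
    simp only [Finset.mem_map, Finset.mem_range, addRightEmbedding_apply, Finset.mem_filter] at he ⊢
    omega
  rw [← Finset.sum_subset hsub, Finset.sum_map]
  · simp
  · intro e he hne
    apply homogeneousComponent_eq_zero
    simp only [Finset.mem_map, Finset.mem_range, addRightEmbedding_apply, Finset.mem_filter,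
      not_exists, not_and] at he hne
    have := hne (e - deg i)
    omega

theorem isHomogeneousVec_single_monomial (deg : ι → ℕ) (j : ι) (u : Fin n →₀ ℕ) (c : k) :
    IsHomogeneousVec deg (u.degree + deg j) (Finsupp.single j (monomial u c)) := by
  have := (isHomogeneousVec_single_one (n := n) (k := k) deg j).smul
    (isHomogeneous_monomial c (rfl : u.degree = u.degree))
  simpa using this

/-- Two `k`-linear maps out of a free `S`-module agree if they agree on the vectors `t ^ u • e j`. -/
theorem finsupp_linearMap_ext {M : Type*} [AddCommMonoid M] [Module k M]
    {f g : (ι →₀ MvPolynomial (Fin n) k) →ₗ[k] M}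
    (h : ∀ j u, f (Finsupp.single j (monomial u 1)) = g (Finsupp.single j (monomial u 1))) :
    f = g := by
  refine Finsupp.lhom_ext' fun j => ?_
  refine (MvPolynomial.basisMonomials (Fin n) k).ext fun u => ?_
  simpa using h j u

theorem IsHomogeneousVec.map {degι : ι → ℕ} {degκ : κ → ℕ}
    {f : (ι →₀ MvPolynomial (Fin n) k) →ₗ[MvPolynomial (Fin n) k] (κ →₀ MvPolynomial (Fin n) k)}
    (hf : ∀ j, IsHomogeneousVec degκ (degι j) (f (Finsupp.single j 1)))
    {e : ℕ} {x : ι →₀ MvPolynomial (Fin n) k} (hx : IsHomogeneousVec degι e x) :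
    IsHomogeneousVec degκ e (f x) := by
  have hsum : f x = ∑ j ∈ x.support, x j • f (Finsupp.single j 1) := by
    conv_lhs => rw [← x.sum_single]
    rw [Finsupp.sum, map_sum]
    exact Finset.sum_congr rfl fun j _ => by rw [← map_smul]; simp
  rw [hsum]
  refine Finset.sum_induction _ (IsHomogeneousVec degκ e) (fun _ _ => .add)
    (isHomogeneousVec_zero _ _) fun j hj => ?_
  obtain ⟨m, hm, hm'⟩ := hx j (by simpa using hj)
  have := (hf j).smul hm'
  rwa [add_comm, hm] at this

/-- It suffices to compare both sides on monomial multiples of basis elements, which are homogeneous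
and stay so under `f`. This allows kernel elements and preimages to be replaced by homogeneous ones.
-/
theorem map_gradedComponent {degι : ι → ℕ} {degκ : κ → ℕ}
    {f : (ι →₀ MvPolynomial (Fin n) k) →ₗ[MvPolynomial (Fin n) k] (κ →₀ MvPolynomial (Fin n) k)}
    (hf : ∀ j, IsHomogeneousVec degκ (degι j) (f (Finsupp.single j 1)))
    (e : ℕ) (x : ι →₀ MvPolynomial (Fin n) k) :
    f (gradedComponent degι e x) = gradedComponent degκ e (f x) := by
  have key : (f.restrictScalars k) ∘ₗ gradedComponent degι e =
      gradedComponent degκ e ∘ₗ (f.restrictScalars k) := by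
    refine finsupp_linearMap_ext fun j u => ?_
    have hj := isHomogeneousVec_single_monomial (k := k) degι j u 1
    simp only [LinearMap.comp_apply, LinearMap.restrictScalars_apply]
    rw [hj.gradedComponent_eq, (hj.map hf).gradedComponent_eq]
    split_ifs <;> simp
  exact LinearMap.congr_fun key x

/-- A homogeneous vector whose degree differs from the degrees of all basis elements lies in
`𝔪F`. -/
theorem IsHomogeneousVec.mem_maxIdeal_smul_top {deg : ι → ℕ} {e : ℕ}
    {x : ι →₀ MvPolynomial (Fin n) k} (hx : IsHomogeneousVec deg e x) (hne : ∀ i, deg i ≠ e) :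
    x ∈ (maxIdeal k n • ⊤ : Submodule (MvPolynomial (Fin n) k) (ι →₀ MvPolynomial (Fin n) k)) := by
  rw [← x.sum_single]
  refine Submodule.sum_mem _ fun i hi => ?_
  obtain ⟨m, hm, hm'⟩ := hx i (by simpa using hi)
  -- The form `x i` has degree `e - deg i`, which is positive, so it has no constant term.
  have hmem : x i ∈ maxIdeal k n := by
    rw [maxIdeal, ← Set.image_univ, mem_ideal_span_X_image]
    intro u hu
    have hu' := hm' (mem_support_iff.1 hu)
    by_contra! h
    have : u = 0 := Finsupp.ext fun i => by simpa using h i trivial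
    subst this
    apply hne i
    simp at hu'
    omega
  have := Submodule.smul_mem_smul hmem
    (Submodule.mem_top (x := Finsupp.single i (1 : MvPolynomial (Fin n) k)))
  simpa using this

end Graded

/-! ### Extending a homogeneous presentation to a graded free resolution. -/

section Stages

variable {k : Type u} [Field k] {n : ℕ}

/-- A homogeneous map of degree `0` between graded free modules. -/
structure GradedMap (k : Type u) [Field k] (n : ℕ) where
  /-- index set of the basis of the target -/
  tgt : Type u
  /-- index set of the basis of the source -/
  src : Type u
  /-- degrees of the basis of the target -/
  degTgt : tgt → ℕ
  /-- degrees of the basis of the source -/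
  degSrc : src → ℕ
  /-- the map itself -/
  map : (src →₀ MvPolynomial (Fin n) k) →ₗ[MvPolynomial (Fin n) k]
    (tgt →₀ MvPolynomial (Fin n) k)
  homogeneous : ∀ j, IsHomogeneousVec degTgt (degSrc j) (map (Finsupp.single j 1))

/-- The map onto the kernel of `f` whose source has a basis element for each homogeneous element
of the kernel. -/
def GradedMap.kernelCover (f : GradedMap k n) : GradedMap k n where
  tgt := f.src
  src := {p : ℕ × (f.src →₀ MvPolynomial (Fin n) k) //
    IsHomogeneousVec f.degSrc p.1 p.2 ∧ f.map p.2 = 0}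
  degTgt := f.degSrc
  degSrc p := p.1.1
  map := Finsupp.linearCombination _ fun p => p.1.2
  homogeneous p := by simpa using p.2.1

/-- The graded components of a kernel element are again in the kernel, so homogeneous elements span
it. -/
theorem GradedMap.range_kernelCover (f : GradedMap k n) :
    LinearMap.ker f.map = LinearMap.range f.kernelCover.map := by
  change _ = LinearMap.range (Finsupp.linearCombination (MvPolynomial (Fin n) k) _)
  rw [Finsupp.range_linearCombination]
  apply le_antisymm
  · intro x hx
    rw [LinearMap.mem_ker] at hx
    obtain ⟨s, hs⟩ := exists_sum_gradedComponent f.degSrc x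
    rw [hs]
    refine Submodule.sum_mem _ fun e _ => Submodule.subset_span
      ⟨⟨(e, gradedComponent f.degSrc e x), isHomogeneousVec_gradedComponent _ _ _, ?_⟩, rfl⟩
    rw [map_gradedComponent f.homogeneous, hx, map_zero]
  · rw [Submodule.span_le]
    rintro _ ⟨p, rfl⟩
    exact p.2.2

/-- Iterated kernel covers. -/
def GradedMap.stage (f : GradedMap k n) : ℕ → GradedMap k n
  | 0 => f
  | s + 1 => (f.stage s).kernelCover

/-- A homogeneous presentation of `I` extends to a graded free resolution. -/
def GradedMap.resolution {I : Ideal (MvPolynomial (Fin n) k)} (f : GradedMap k n)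
    (ε : (f.tgt →₀ MvPolynomial (Fin n) k) →ₗ[MvPolynomial (Fin n) k] MvPolynomial (Fin n) k)
    (hε : ∀ j, (ε (Finsupp.single j 1)).IsHomogeneous (f.degTgt j))
    (hI : LinearMap.range ε = I) (hf : LinearMap.ker ε = LinearMap.range f.map) :
    GradedFreeResolution I where
  ι s := (f.stage s).tgt
  deg s := (f.stage s).degTgt
  d s := (f.stage s).map
  ε := ε
  d_homogeneous s := (f.stage s).homogeneous
  ε_homogeneous := hε
  range_ε := hI
  exact_zero := hf
  exact_succ s := (f.stage s).range_kernelCover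

/-- An ideal with a presentation whose generators and relations have degrees `d` and `d + 1` is
linearly presented. -/
theorem GradedMap.isLinearlyPresented {I : Ideal (MvPolynomial (Fin n) k)} (f : GradedMap k n)
    (ε : (f.tgt →₀ MvPolynomial (Fin n) k) →ₗ[MvPolynomial (Fin n) k] MvPolynomial (Fin n) k)
    (hε : ∀ j, (ε (Finsupp.single j 1)).IsHomogeneous (f.degTgt j))
    (hI : LinearMap.range ε = I) (hf : LinearMap.ker ε = LinearMap.range f.map) {d : ℕ}
    (h0 : ∀ j, f.degTgt j = d) (h1 : ∀ j, f.degSrc j = d + 1) : IsLinearlyPresented I d := by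
  refine ⟨f.resolution ε hε hI hf, fun s hs e he x _ hx => ?_⟩
  refine Submodule.mem_sup_right (hx.mem_maxIdeal_smul_top fun j => ?_)
  obtain rfl | rfl : s = 0 ∨ s = 1 := by omega
  · exact fun h => he (h ▸ h0 j)
  · exact fun h => he (h ▸ h1 j)

end Stages

/-! ### Square-free exponent vectors and paths of triples. -/

section Squarefree

variable {σ : Type*}

/-- The exponent vector of the square-free monomial with support `A`. -/
def chi (A : Finset σ) : σ →₀ ℕ := ∑ i ∈ A, Finsupp.single i 1

theorem chi_apply [DecidableEq σ] (A : Finset σ) (i : σ) : chi A i = if i ∈ A then 1 else 0 := by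
  simp [chi, Finsupp.finsetSum_apply, Finsupp.single_apply]

theorem monomial_chi {k : Type*} [CommSemiring k] (A : Finset σ) :
    monomial (chi A) (1 : k) = ∏ i ∈ A, X i := by
  classical
  simp only [chi, X]
  induction A using Finset.induction_on with
  | empty => simp
  | insert a A ha ih =>
    rw [Finset.sum_insert ha, Finset.prod_insert ha, ← ih, monomial_mul, one_mul]

theorem degree_chi (A : Finset σ) : (chi A).degree = A.card := by
  simp [chi, map_sum]

theorem chi_le_iff {A : Finset σ} {u : σ →₀ ℕ} : chi A ≤ u ↔ ∀ i ∈ A, u i ≠ 0 := by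
  classical
  rw [Finsupp.le_def]
  refine forall_congr' fun i => ?_
  rw [chi_apply]
  split_ifs with h <;> simp [h, Nat.one_le_iff_ne_zero]

theorem chi_le_chi {A B : Finset σ} : chi A ≤ chi B ↔ A ⊆ B := by
  classical
  simp [chi_le_iff, chi_apply, Finset.subset_iff]

theorem chi_inf [DecidableEq σ] (A B : Finset σ) : chi A ⊓ chi B = chi (A ∩ B) := by
  ext i
  simp only [Finsupp.inf_apply, chi_apply, Finset.mem_inter]
  split_ifs <;> simp_all

theorem mapDomain_chi {τ : Type*} (e : σ ↪ τ) (A : Finset σ) :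
    Finsupp.mapDomain e (chi A) = chi (A.map e) := by
  simp [chi, Finsupp.mapDomain_finsetSum]

theorem sqfree_eq_chi (A : Finset (Fin 6)) : sqfree A = chi A := rfl

/-- `A` and `B` are members of `H` inside `K` with at least two common elements; for a family of
triples this means that they are equal or adjacent in the dual graph. -/
def Step [DecidableEq σ] (H : Set (Finset σ)) (K A B : Finset σ) : Prop :=
  A ∈ H ∧ B ∈ H ∧ A ⊆ K ∧ B ⊆ K ∧ 2 ≤ (A ∩ B).card

/-- The triples in `H` that are contained in `K` are pairwise joined by a path inside `K`. -/
def Linked [DecidableEq σ] (H : Set (Finset σ)) (K : Finset σ) : Prop :=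
  ∀ A ∈ H, ∀ B ∈ H, A ⊆ K → B ⊆ K → Relation.ReflTransGen (Step H K) A B

variable [DecidableEq σ] {H : Set (Finset σ)} {K L A B : Finset σ}

theorem Step.mono (hKL : K ⊆ L) (h : Step H K A B) : Step H L A B :=
  ⟨h.1, h.2.1, h.2.2.1.trans hKL, h.2.2.2.1.trans hKL, h.2.2.2.2⟩

theorem path_mono (hKL : K ⊆ L) (h : Relation.ReflTransGen (Step H K) A B) :
    Relation.ReflTransGen (Step H L) A B := 
  Relation.ReflTransGen.mono (fun _ _ => Step.mono hKL) _ _ h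

end Squarefree

/-! ### Reduction of missing paths to configurations on five or six vertices. -/

section Combinatorics

variable {σ : Type*} [DecidableEq σ] {H : Set (Finset σ)} {K A B : Finset σ}

/-- Two triples `A`, `B` that span five vertices but are not joined by a path inside `A ∪ B`: for
one of them, all other triples inside `A ∪ B` contain its complement. -/
theorem complement_subset_of_not_path (hH : ∀ A ∈ H, A.card = 3) (hA : A ∈ H) (hB : B ∈ H)
    (hK : (A ∪ B).card = 5) (hAB : ¬ Relation.ReflTransGen (Step H (A ∪ B)) A B) :
    (∀ T ∈ H, T ⊆ A ∪ B → T ≠ A → (A ∪ B) \ A ⊆ T) ∨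
      (∀ T ∈ H, T ⊆ A ∪ B → T ≠ B → (A ∪ B) \ B ⊆ T) := by
  -- The complement of `A` has two elements, so a triple that misses one of them meets `A` in two.
  -- If it is also not close to `B`, counting shows that it avoids the single point of `A ∩ B`.
  have key : ∀ A B T : Finset σ, A ∈ H → B ∈ H → T ∈ H → (A ∪ B).card = 5 → T ⊆ A ∪ B → T ≠ A →
      ¬ (A ∪ B) \ A ⊆ T → 2 ≤ (A ∩ T).card ∧ (¬ 2 ≤ (B ∩ T).card → T ⊆ (A ∪ B) \ (A ∩ B)) := by
    intro A B T hA hB hT hK hTK hne hsub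
    have h1 := Finset.card_union_add_card_inter A B
    have cA := hH A hA
    have cB := hH B hB
    have cT := hH T hT
    have hAT : 2 ≤ (A ∩ T).card := by
      have h2 : (T \ A).card < ((A ∪ B) \ A).card := by
        refine Finset.card_lt_card (Finset.ssubset_iff_subset_ne.2
          ⟨Finset.sdiff_subset_sdiff hTK le_rfl, fun h => hsub (h ▸ Finset.sdiff_subset)⟩)
      have h3 := Finset.card_sdiff_add_card_eq_card (s := A) (t := A ∪ B) Finset.subset_union_left
      have h4 := Finset.card_sdiff_add_card_inter T A
      rw [Finset.inter_comm] at h4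
      omega
    refine ⟨hAT, fun hBT => ?_⟩
    have h5 : (A ∩ T).card ≠ 3 := by
      intro h
      have e1 := Finset.eq_of_subset_of_card_le (Finset.inter_subset_left (s₁ := A) (s₂ := T))
        (by omega)
      have e2 := Finset.eq_of_subset_of_card_le (Finset.inter_subset_right (s₁ := A) (s₂ := T))
        (by omega)
      exact hne (e2.symm.trans e1)
    have h6 : (A ∩ T).card ≤ 3 := cA ▸ Finset.card_le_card Finset.inter_subset_left
    have h7 := Finset.card_union_add_card_inter (A ∩ T) (B ∩ T)
    rw [← Finset.union_inter_distrib_right, Finset.inter_eq_right.2 hTK,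
      ← Finset.inter_inter_distrib_right] at h7
    have h8 : (A ∩ B) ∩ T = ∅ := Finset.card_eq_zero.1 (by omega)
    intro t ht
    refine Finset.mem_sdiff.2 ⟨hTK ht, fun h => ?_⟩
    exact Finset.notMem_empty t (h8 ▸ Finset.mem_inter.2 ⟨h, ht⟩)
  by_contra! hcon
  obtain ⟨⟨T, hT, hTK, hTA, hTs⟩, U, hU, hUK, hUB, hUs⟩ := hcon
  obtain ⟨hAT, hT'⟩ := key A B T hA hB hT hK hTK hTA hTs
  obtain ⟨hBU, hU'⟩ := key B A U hB hA hU (by rwa [Finset.union_comm])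
    (by rwa [Finset.union_comm]) hUB (by rwa [Finset.union_comm])
  rw [Finset.union_comm B A, Finset.inter_comm B A] at hU'
  have hlA : A ⊆ A ∪ B := Finset.subset_union_left
  have hlB : B ⊆ A ∪ B := Finset.subset_union_right
  have sAT : Step H (A ∪ B) A T := ⟨hA, hT, hlA, hTK, hAT⟩
  have sUB : Step H (A ∪ B) U B := ⟨hU, hB, hUK, hlB, by rwa [Finset.inter_comm]⟩
  by_cases hBT : 2 ≤ (B ∩ T).card
  · exact hAB (.head sAT (.single ⟨hT, hB, hTK, hlB, by rwa [Finset.inter_comm]⟩))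
  by_cases hAU : 2 ≤ (A ∩ U).card
  · exact hAB (.head ⟨hA, hU, hlA, hUK, hAU⟩ (.single sUB))
  have h1 := Finset.card_union_add_card_inter A B
  have h2 := Finset.card_union_add_card_inter T U
  have h3 := Finset.card_le_card (Finset.union_subset (hT' hBT) (hU' hAU))
  have h4 := Finset.card_sdiff_add_card_eq_card (s := A ∩ B) (t := A ∪ B)
    (Finset.inter_subset_left.trans hlA)
  have cA := hH A hA
  have cB := hH B hB
  have cT := hH T hT
  have cU := hH U hU
  -- Both `T` and `U` avoid the common point, so they are triples in a set of four elements and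
  -- share two; the path is `A`, `T`, `U`, `B`.
  exact hAB (.head sAT (.head ⟨hT, hU, hTK, hUK, by omega⟩ (.single sUB)))

theorem path_of_card_union_le_four (hH : ∀ A ∈ H, A.card = 3) (hA : A ∈ H) (hB : B ∈ H)
    (hAK : A ⊆ K) (hBK : B ⊆ K) (hK : K.card ≤ 4) : Relation.ReflTransGen (Step H K) A B := by
  have h1 := Finset.card_union_add_card_inter A B
  have h2 := Finset.card_le_card (Finset.union_subset hAK hBK)
  have cA := hH A hA
  have cB := hH B hB
  exact .single ⟨hA, hB, hAK, hBK, by omega⟩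

/-- The hypotheses `h5` and `h6` say that configurations of the shapes of patterns two and one are
connected whenever they occur. Five vertices are handled by `complement_subset_of_not_path`, and six
vertices reduce to at most five by inserting a third triple. -/
theorem path_of_no_obstruction (hH : ∀ A ∈ H, A.card = 3)
    (h5 : ∀ K : Finset σ, K.card = 5 → ∀ A ∈ H, A ⊆ K →
      (∀ T ∈ H, T ⊆ K → T ≠ A → K \ A ⊆ T) → Linked H K)
    (h6 : ∀ A ∈ H, ∀ B ∈ H, (A ∪ B).card = 6 → (∀ T ∈ H, T ⊆ A ∪ B → T = A ∨ T = B) →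
      Linked H (A ∪ B)) (hA : A ∈ H) (hB : B ∈ H) :
    Relation.ReflTransGen (Step H (A ∪ B)) A B := by
  have five : ∀ A ∈ H, ∀ B ∈ H, (A ∪ B).card ≤ 5 →
      Relation.ReflTransGen (Step H (A ∪ B)) A B := by
    intro A hA B hB hK
    have hlA : A ⊆ A ∪ B := Finset.subset_union_left
    have hlB : B ⊆ A ∪ B := Finset.subset_union_right
    obtain hK | hK : (A ∪ B).card ≤ 4 ∨ (A ∪ B).card = 5 := by omega
    · exact path_of_card_union_le_four hH hA hB hlA hlB hK
    by_contra hcon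
    obtain h | h := complement_subset_of_not_path hH hA hB hK hcon
    · exact hcon (h5 _ hK A hA hlA h A hA B hB hlA hlB)
    · exact hcon (h5 _ hK B hB hlB h A hA B hB hlA hlB)
  have hlA : A ⊆ A ∪ B := Finset.subset_union_left
  have hlB : B ⊆ A ∪ B := Finset.subset_union_right
  have cA := hH A hA
  have cB := hH B hB
  have h1 := Finset.card_union_add_card_inter A B
  obtain hK | hK : (A ∪ B).card ≤ 5 ∨ (A ∪ B).card = 6 := by omega
  · exact five A hA B hB hK
  by_contra hcon
  refine hcon (h6 A hA B hB hK (fun T hT hTK => ?_) A hA B hB hlA hlB)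
  by_contra! hne
  have cT := hH T hT
  have h7 := Finset.card_union_add_card_inter (A ∩ T) (B ∩ T)
  rw [← Finset.union_inter_distrib_right, Finset.inter_eq_right.2 hTK,
    ← Finset.inter_inter_distrib_right] at h7
  have eq_of : ∀ A ∈ H, (A ∩ T).card = 3 → T = A := by
    intro A hA h
    have e1 := Finset.eq_of_subset_of_card_le (Finset.inter_subset_left (s₁ := A) (s₂ := T))
      (by rw [h, hH A hA])
    have e2 := Finset.eq_of_subset_of_card_le (Finset.inter_subset_right (s₁ := A) (s₂ := T))
      (by omega)
    exact e2.symm.trans e1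
  -- Here `A` and `B` are disjoint and `T` differs from both, so `T` meets each of them, and `A ∪ T`
  -- and `T ∪ B` have at most five elements.
  have hA3 : (A ∩ T).card ≠ 3 := fun h => hne.1 (eq_of A hA h)
  have hB3 : (B ∩ T).card ≠ 3 := fun h => hne.2 (eq_of B hB h)
  have hA4 : (A ∩ T).card ≤ 3 := cA ▸ Finset.card_le_card Finset.inter_subset_left
  have hB4 : (B ∩ T).card ≤ 3 := cB ▸ Finset.card_le_card Finset.inter_subset_left
  have h8 := Finset.card_union_add_card_inter A T
  have h9 := Finset.card_union_add_card_inter T B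
  rw [Finset.inter_comm T B] at h9
  refine hcon ((path_mono (Finset.union_subset hlA hTK) (five A hA T hT (by omega))).trans
    (path_mono (Finset.union_subset hTK hlB) (five T hT B hB (by omega))))

end Combinatorics

/-! ### Paths imply a linear presentation. -/

section Presentation

variable {n : ℕ}

/-- The basis indexed by `H` of the free module that covers the ideal with generators `H`. -/
abbrev GenIndex (H : Set (Finset (Fin n))) : Type u := ULift.{u} H

variable (k : Type u) [Field k] (H : Set (Finset (Fin n)))

/-- The map onto the ideal generated by the square-free monomials with supports in `H`. -/
def augmentation : (GenIndex.{u} H →₀ MvPolynomial (Fin n) k) →ₗ[MvPolynomial (Fin n) k]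
    MvPolynomial (Fin n) k :=
  Finsupp.linearCombination _ fun A => monomial (chi A.down.1) 1

theorem augmentation_single (A : GenIndex.{u} H) (p : MvPolynomial (Fin n) k) :
    augmentation k H (Finsupp.single A p) = p * monomial (chi A.down.1) 1 := by
  simp [augmentation]

theorem range_augmentation : LinearMap.range (augmentation k H) =
    Ideal.span ((fun A : Finset (Fin n) => ∏ i ∈ A, (X i : MvPolynomial (Fin n) k)) '' H) := by
  rw [augmentation, Finsupp.range_linearCombination]
  refine congrArg (Submodule.span _) (Set.ext fun p => ?_)
  simp [monomial_chi]

/-- The submodule generated by the relations of degree `d + 1` among the generators. -/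
def linearRelations (d : ℕ) :
    Submodule (MvPolynomial (Fin n) k) (GenIndex.{u} H →₀ MvPolynomial (Fin n) k) :=
  Submodule.span _ {x | IsHomogeneousVec (fun _ => d) (d + 1) x ∧ augmentation k H x = 0}

variable {k H}

theorem linearRelations_le (d : ℕ) : linearRelations k H d ≤ LinearMap.ker (augmentation k H) :=
  Submodule.span_le.2 fun _ hx => hx.2

theorem chi_add_chi_sdiff (A B : Finset (Fin n)) : chi (B \ A) + chi A = chi (A \ B) + chi B := by
  ext i
  simp only [Finsupp.add_apply, chi_apply, Finset.mem_sdiff]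
  split_ifs <;> simp_all

/-- For `A ≠ B` the difference is a monomial multiple of the relation with coefficients `B \ A` and
`A \ B`. Each of these sets has one element, so that relation has degree 4. -/
theorem single_sub_single_mem_linearRelations (hH : ∀ A ∈ H, A.card = 3) {A B : GenIndex.{u} H}
    (hAB : 2 ≤ (A.down.1 ∩ B.down.1).card) {u v : Fin n →₀ ℕ}
    (huv : u + chi A.down.1 = v + chi B.down.1) :
    Finsupp.single A (monomial u (1 : k)) - Finsupp.single B (monomial v 1) ∈
      linearRelations k H 3 := by
  by_cases hne : A = B
  · subst hne
    obtain rfl : u = v := add_right_cancel huv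
    simp
  have hu : chi (B.down.1 \ A.down.1) ≤ u := by
    refine chi_le_iff.2 fun i hi => ?_
    rw [Finset.mem_sdiff] at hi
    have := DFunLike.congr_fun huv i
    simp only [Finsupp.add_apply, chi_apply, hi.1, hi.2, if_true, if_false] at this
    omega
  obtain ⟨w, rfl⟩ := (exists_add_of_le hu).imp fun w hw => hw.trans (add_comm _ w)
  obtain rfl : v = w + chi (A.down.1 \ B.down.1) := by
    rw [add_assoc, chi_add_chi_sdiff, ← add_assoc] at huv
    exact (add_right_cancel huv).symm
  have cA := hH _ A.down.2
  have cB := hH _ B.down.2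
  have h3 : (A.down.1 ∩ B.down.1).card ≠ 3 := by
    intro h
    have e1 := Finset.eq_of_subset_of_card_le
      (Finset.inter_subset_left (s₁ := A.down.1) (s₂ := B.down.1)) (by omega)
    have e2 := Finset.eq_of_subset_of_card_le
      (Finset.inter_subset_right (s₁ := A.down.1) (s₂ := B.down.1)) (by omega)
    exact hne (ULift.ext _ _ (Subtype.ext (e1.symm.trans e2)))
  have h2 : (A.down.1 ∩ B.down.1).card ≤ 3 := cA ▸ Finset.card_le_card Finset.inter_subset_left
  have h4 := Finset.card_sdiff_add_card_inter A.down.1 B.down.1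
  have h5 := Finset.card_sdiff_add_card_inter B.down.1 A.down.1
  rw [Finset.inter_comm] at h5
  have hmem := Submodule.smul_mem _ (monomial w (1 : k)) (Submodule.subset_span (s := {x |
    IsHomogeneousVec (fun _ => 3) (3 + 1) x ∧ augmentation k H x = 0})
    (a := Finsupp.single A (monomial (chi (B.down.1 \ A.down.1)) 1) -
      Finsupp.single B (monomial (chi (A.down.1 \ B.down.1)) 1)) ⟨?_, ?_⟩)
  · rw [smul_sub, Finsupp.smul_single, Finsupp.smul_single, smul_eq_mul, smul_eq_mul,
      monomial_mul, monomial_mul, one_mul] at hmem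
    exact hmem
  · have hA := isHomogeneousVec_single_monomial (k := k) (fun _ => 3) A
      (chi (B.down.1 \ A.down.1)) 1
    have hB := isHomogeneousVec_single_monomial (k := k) (fun _ => 3) B
      (chi (A.down.1 \ B.down.1)) 1
    rw [degree_chi, show (B.down.1 \ A.down.1).card + 3 = 3 + 1 by omega] at hA
    rw [degree_chi, show (A.down.1 \ B.down.1).card + 3 = 3 + 1 by omega] at hB
    rw [sub_eq_add_neg]
    exact hA.add hB.neg
  · rw [map_sub, augmentation_single, augmentation_single, monomial_mul, monomial_mul,
      chi_add_chi_sdiff, sub_self]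

/-- The difference telescopes along the path: each triple on it lies in `K`, so its monomial divides
the monomial with exponent `α`. -/
theorem single_sub_single_mem_linearRelations_of_path (hH : ∀ A ∈ H, A.card = 3)
    {K A B : Finset (Fin n)}
    (hA : A ∈ H) (hAB : Relation.ReflTransGen (Step H K) A B) {α : Fin n →₀ ℕ}
    (hα : chi K ≤ α) (hB : B ∈ H) :
    Finsupp.single (ULift.up ⟨A, hA⟩ : GenIndex.{u} H) (monomial (α - chi A) (1 : k)) -
        Finsupp.single (ULift.up ⟨B, hB⟩) (monomial (α - chi B) 1) ∈
      linearRelations k H 3 := by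
  induction hAB with
  | refl => simp
  | @tail B C _ h ih =>
    obtain ⟨hB', _, hBK, hCK, hc⟩ := h
    rw [← sub_add_sub_cancel _ (Finsupp.single (ULift.up ⟨B, hB'⟩ : GenIndex.{u} H) _) _]
    refine Submodule.add_mem _ (ih hB') (single_sub_single_mem_linearRelations hH hc ?_)
    rw [tsub_add_cancel_of_le ((chi_le_chi.2 hBK).trans hα),
      tsub_add_cancel_of_le ((chi_le_chi.2 hCK).trans hα)]

theorem ker_augmentation_le (hH : ∀ A ∈ H, A.card = 3)
    (hpath : ∀ A ∈ H, ∀ B ∈ H, Relation.ReflTransGen (Step H (A ∪ B)) A B) :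
    LinearMap.ker (augmentation k H) ≤ linearRelations k H 3 := by
  classical
  set N : Submodule (MvPolynomial (Fin n) k) (GenIndex.{u} H →₀ MvPolynomial (Fin n) k) :=
    linearRelations k H 3 with hN
  -- A `k`-linear left inverse of the augmentation modulo `N`: each monomial of the ideal is written
  -- through an arbitrarily chosen generator dividing it. Paths make the choice irrelevant modulo
  -- `N`; the value 0 on other monomials plays no role. Since `s` composed with the augmentation is
  -- the quotient map, the kernel lies in `N`.
  let s : MvPolynomial (Fin n) k →ₗ[k] (GenIndex.{u} H →₀ MvPolynomial (Fin n) k) ⧸ N :=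
    (basisMonomials (Fin n) k).constr k fun α =>
      if h : ∃ A : GenIndex.{u} H, chi A.down.1 ≤ α then
        N.mkQ (Finsupp.single h.choose (monomial (α - chi h.choose.down.1) 1)) else 0
  have hs : s ∘ₗ (augmentation k H).restrictScalars k = N.mkQ.restrictScalars k := by
    refine finsupp_linearMap_ext fun A u => ?_
    have hex : ∃ B : GenIndex.{u} H, chi B.down.1 ≤ u + chi A.down.1 := ⟨A, le_add_self⟩
    have h1 : s (monomial (u + chi A.down.1) 1) = N.mkQ (Finsupp.single hex.choose
        (monomial (u + chi A.down.1 - chi hex.choose.down.1) 1)) := by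
      have := (basisMonomials (Fin n) k).constr_basis k (fun α =>
        if h : ∃ A : GenIndex.{u} H, chi A.down.1 ≤ α then
          N.mkQ (Finsupp.single h.choose (monomial (α - chi h.choose.down.1) 1)) else 0)
        (u + chi A.down.1)
      rw [dif_pos hex, coe_basisMonomials] at this
      exact this
    rw [LinearMap.comp_apply, LinearMap.restrictScalars_apply, augmentation_single, monomial_mul,
      one_mul, h1, LinearMap.restrictScalars_apply, ← sub_eq_zero, ← map_sub,
      Submodule.mkQ_apply, Submodule.Quotient.mk_eq_zero]
    have hB := hex.choose_spec
    generalize hex.choose = B at hB ⊢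
    have := single_sub_single_mem_linearRelations_of_path (k := k) hH B.down.2
      (hpath _ B.down.2 _ A.down.2) (α := u + chi A.down.1) (chi_le_iff.2 fun i hi => ?_) A.down.2
    · rwa [add_tsub_cancel_right] at this
    · obtain h | h := Finset.mem_union.1 hi
      · exact chi_le_iff.1 hB i h
      · exact chi_le_iff.1 le_add_self i h
  intro x hx
  have := LinearMap.congr_fun hs x
  rw [LinearMap.comp_apply, LinearMap.restrictScalars_apply, LinearMap.mem_ker.1 hx, map_zero] at this
  exact (Submodule.Quotient.mk_eq_zero N).1 this.symm

theorem isLinearlyPresented_of_path (hH : ∀ A ∈ H, A.card = 3)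
    (hpath : ∀ A ∈ H, ∀ B ∈ H, Relation.ReflTransGen (Step H (A ∪ B)) A B) :
    IsLinearlyPresented (Ideal.span ((fun A : Finset (Fin n) =>
      ∏ i ∈ A, (X i : MvPolynomial (Fin n) k)) '' H)) 3 := by
  let f : GradedMap k n :=
    { tgt := GenIndex.{u} H
      src := {x : GenIndex.{u} H →₀ MvPolynomial (Fin n) k //
        IsHomogeneousVec (fun _ => 3) (3 + 1) x ∧ augmentation k H x = 0}
      degTgt := fun _ => 3
      degSrc := fun _ => 4
      map := Finsupp.linearCombination _ Subtype.val
      homogeneous := fun x => by simpa using x.2.1 }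
  have hε : ∀ A : GenIndex.{u} H,
      (augmentation k H (Finsupp.single A 1)).IsHomogeneous 3 := fun A => by
    rw [augmentation_single, one_mul]
    exact isHomogeneous_monomial _ ((degree_chi _).trans (hH _ A.down.2))
  have hrange : linearRelations k H 3 = LinearMap.range (Finsupp.linearCombination
      (MvPolynomial (Fin n) k) (Subtype.val : {x : GenIndex.{u} H →₀ MvPolynomial (Fin n) k //
        IsHomogeneousVec (fun _ => 3) (3 + 1) x ∧ augmentation k H x = 0} → _)) := by
    rw [Finsupp.range_linearCombination]
    exact congrArg (Submodule.span _) Subtype.range_coe_subtype.symm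
  exact f.isLinearlyPresented (augmentation k H) hε (range_augmentation k H)
    ((le_antisymm (ker_augmentation_le hH hpath) (linearRelations_le 3)).trans hrange)
    (fun _ => rfl) (fun _ => rfl)

end Presentation

/-! ### A linear presentation implies paths inside every vertex set. -/

section Necessity

variable {k : Type u} [Field k] {n : ℕ}

theorem map_gradedComponent_eq_homogeneousComponent {ι : Type u} {deg : ι → ℕ}
    {ε : (ι →₀ MvPolynomial (Fin n) k) →ₗ[MvPolynomial (Fin n) k] MvPolynomial (Fin n) k}
    (hε : ∀ j, (ε (Finsupp.single j 1)).IsHomogeneous (deg j))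
    (e : ℕ) (x : ι →₀ MvPolynomial (Fin n) k) :
    ε (gradedComponent deg e x) = homogeneousComponent e (ε x) := by
  have key : (ε.restrictScalars k) ∘ₗ gradedComponent deg e =
      homogeneousComponent e ∘ₗ (ε.restrictScalars k) := by
    refine finsupp_linearMap_ext fun j u => ?_
    have hj := isHomogeneousVec_single_monomial (k := k) deg j u 1
    have h : (ε (Finsupp.single j (monomial u 1))).IsHomogeneous (u.degree + deg j) := by
      have := (isHomogeneous_monomial (1 : k) (rfl : u.degree = u.degree)).mul (hε j)
      rwa [← smul_eq_mul, ← map_smul, Finsupp.smul_single, smul_eq_mul, mul_one] at this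
    simp only [LinearMap.comp_apply, LinearMap.restrictScalars_apply]
    rw [hj.gradedComponent_eq, homogeneousComponent_of_mem h]
    simp only [eq_comm (a := e)]
    split_ifs <;> simp
  exact LinearMap.congr_fun key x

theorem map_mem_smul {M N : Type*} {R : Type*} [CommRing R] [AddCommGroup M] [Module R M]
    [AddCommGroup N] [Module R N] (J : Ideal R) (f : M →ₗ[R] N) {P : Submodule R M}
    {Q : Submodule R N} (hf : ∀ x ∈ P, f x ∈ Q) {x : M} (hx : x ∈ J • P) : f x ∈ J • Q := by
  have h := Submodule.mem_map_of_mem (f := f) hx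
  rw [Submodule.map_smul''] at h
  exact Submodule.smul_mono le_rfl (Submodule.map_le_iff_le_comap.2 hf) h

/-- If `I` is linearly presented, a homogeneous relation among its generators of degree greater
than `4` is not a minimal relation. -/
theorem mem_maxIdeal_smul_ker {H : Set (Finset (Fin n))} (hH : ∀ A ∈ H, A.card = 3)
    (h : IsLinearlyPresented (Ideal.span ((fun A : Finset (Fin n) =>
      ∏ i ∈ A, (X i : MvPolynomial (Fin n) k)) '' H)) 3) {e : ℕ} (he : 4 < e)
    {z : GenIndex.{u} H →₀ MvPolynomial (Fin n) k} (hz : IsHomogeneousVec (fun _ => 3) e z)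
    (hz0 : augmentation k H z = 0) :
    z ∈ maxIdeal k n • LinearMap.ker (augmentation k H) := by
  obtain ⟨F, hF⟩ := h
  have hrange : LinearMap.range (augmentation k H) = LinearMap.range F.ε :=
    (range_augmentation k H).trans F.range_ε.symm
  have hp : ∀ A : GenIndex.{u} H, ∃ x, IsHomogeneousVec (F.deg 0) 3 x ∧
      F.ε x = augmentation k H (Finsupp.single A 1) := by
    intro A
    obtain ⟨x, hx⟩ : augmentation k H (Finsupp.single A 1) ∈ LinearMap.range F.ε :=
      hrange ▸ LinearMap.mem_range_self _ _
    refine ⟨gradedComponent (F.deg 0) 3 x, isHomogeneousVec_gradedComponent _ _ _, ?_⟩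
    rw [map_gradedComponent_eq_homogeneousComponent F.ε_homogeneous, hx, augmentation_single,
      one_mul, homogeneousComponent_of_mem
        (isHomogeneous_monomial (1 : k) ((degree_chi A.down.1).trans (hH _ A.down.2))), if_pos rfl]
  -- The identity of the ideal lifts to maps `p` and `q` between the two free covers. Only `p` has
  -- to respect degrees, so that `p z` is homogeneous of degree `e`.
  choose p₀ hp₀ hp₁ using hp
  have hq : ∀ j, ∃ x, augmentation k H x = F.ε (Finsupp.single j 1) := fun j =>
    show _ ∈ LinearMap.range (augmentation k H) from hrange ▸ LinearMap.mem_range_self _ _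
  choose q₀ hq₀ using hq
  let p := Finsupp.linearCombination (MvPolynomial (Fin n) k) p₀
  let q := Finsupp.linearCombination (MvPolynomial (Fin n) k) q₀
  have hεp : F.ε ∘ₗ p = augmentation k H := Finsupp.lhom_ext' fun A => LinearMap.ext_ring <| by
    simp [p, hp₁]
  have hεq : augmentation k H ∘ₗ q = F.ε := Finsupp.lhom_ext' fun j => LinearMap.ext_ring <| by
    simp [q, hq₀]
  have hpz : IsHomogeneousVec (F.deg 0) e (p z) := hz.map fun A => by simpa [p] using hp₀ A
  have hzm := hz.mem_maxIdeal_smul_top fun _ => by omega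
  obtain ⟨y₀, hy₀⟩ : p z ∈ LinearMap.range (F.d 0) := by
    rw [← F.exact_zero, LinearMap.mem_ker]
    exact (LinearMap.congr_fun hεp z).trans hz0
  have hy : F.d 0 (gradedComponent (F.deg 1) e y₀) = p z := by
    rw [map_gradedComponent (F.d_homogeneous 0), hy₀, hpz.gradedComponent_eq, if_pos rfl]
  -- Since `z` lies in `𝔪` times the free module, so does `p z`; hence its preimage of degree `e` is
  -- a cycle modulo `𝔪`, and the vanishing of `Tor` in homological degree 1 applies because `e ≠ 4`.
  have hb : gradedComponent (F.deg 1) e y₀ ∈ F.boundaries 1 := by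
    refine hF 1 (by omega) e (by omega) _ ?_ (isHomogeneousVec_gradedComponent _ _ _)
    change F.d 0 _ ∈ (maxIdeal k n • ⊤ :
      Submodule (MvPolynomial (Fin n) k) (F.ι 0 →₀ MvPolynomial (Fin n) k))
    rw [hy]
    exact map_mem_smul _ p (fun _ _ => Submodule.mem_top) hzm
  obtain ⟨_, ⟨w, rfl⟩, y, hym, hwy⟩ := Submodule.mem_sup.1 hb
  have hdw : F.d 0 (F.d 1 w) = 0 := by
    rw [← LinearMap.mem_ker, F.exact_succ 0]
    exact LinearMap.mem_range_self _ _
  have hdy : q (F.d 0 y) = q (p z) := by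
    rw [← hy, ← hwy, map_add (F.d 0), hdw]
    exact congrArg q (zero_add _).symm
  have h1 : q (p z) ∈ maxIdeal k n • LinearMap.ker (augmentation k H) := by
    rw [← hdy]
    refine map_mem_smul _ (q ∘ₗ F.d 0) (fun x _ => ?_) hym
    have : F.d 0 x ∈ LinearMap.ker F.ε := F.exact_zero ▸ LinearMap.mem_range_self _ _
    exact (LinearMap.congr_fun hεq _).trans this
  -- The map `id - q ∘ p` sends everything into the kernel, and `z` has coefficients in `𝔪`.
  have h2 : z - q (p z) ∈ maxIdeal k n • LinearMap.ker (augmentation k H) := by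
    refine map_mem_smul _ (LinearMap.id - q ∘ₗ p) (fun x _ => ?_) hzm
    have e1 := LinearMap.congr_fun hεq (p x)
    have e2 := LinearMap.congr_fun hεp x
    simp only [LinearMap.comp_apply] at e1 e2
    rw [LinearMap.mem_ker, LinearMap.sub_apply, map_sub, LinearMap.comp_apply, e1, e2,
      LinearMap.id_apply, sub_self]
  simpa using Submodule.add_mem _ h2 h1

open Classical in
/-- The part of the augmentation that comes from the generators in `W`. -/
def partialAugmentation (k : Type u) [Field k] (H W : Set (Finset (Fin n))) :
    (GenIndex.{u} H →₀ MvPolynomial (Fin n) k) →ₗ[MvPolynomial (Fin n) k]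
      MvPolynomial (Fin n) k :=
  Finsupp.linearCombination _ fun A => if A.down.1 ∈ W then monomial (chi A.down.1) 1 else 0

/-- Only triples inside `K` contribute to this coefficient. By `hW` either all of them lie in `W`,
and it is the coefficient of the full augmentation, or none do. -/
theorem coeff_partialAugmentation_eq_zero {H W : Set (Finset (Fin n))} {K : Finset (Fin n)}
    (hW : ∀ A ∈ H, ∀ B ∈ H, A ⊆ K → B ⊆ K → A ∈ W → B ∈ W)
    {y : GenIndex.{u} H →₀ MvPolynomial (Fin n) k} (hy : augmentation k H y = 0) :
    coeff (chi K) (partialAugmentation k H W y) = 0 := by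
  classical
  by_cases h : ∃ A ∈ H, A ⊆ K ∧ A ∈ W
  · obtain ⟨A, hA, hAK, hAW⟩ := h
    rw [← coeff_zero (chi K), ← hy, partialAugmentation, augmentation,
      Finsupp.linearCombination_apply, Finsupp.linearCombination_apply, Finsupp.sum, Finsupp.sum,
      coeff_sum, coeff_sum]
    refine Finset.sum_congr rfl fun B _ => ?_
    split_ifs with hB
    · rfl
    · have : ¬ chi B.down.1 ≤ chi K := fun hBK =>
        hB (hW A hA _ B.down.2 hAK (chi_le_chi.1 hBK) hAW)
      rw [smul_zero, smul_eq_mul, coeff_mul_monomial', if_neg this, coeff_zero]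
  · push Not at h
    rw [partialAugmentation, Finsupp.linearCombination_apply, Finsupp.sum, coeff_sum]
    refine Finset.sum_eq_zero fun B _ => ?_
    split_ifs with hB
    · have : ¬ chi B.down.1 ≤ chi K := fun hBK => h _ B.down.2 (chi_le_chi.1 hBK) hB
      rw [smul_eq_mul, coeff_mul_monomial', if_neg this]
    · simp

/-- Multiplication by a variable `i ∈ K` moves the coefficient at `K.erase i` to `K`, so the
previous lemma is needed only on the sets `K.erase i`. -/
theorem coeff_partialAugmentation_eq_zero_of_mem_smul {H W : Set (Finset (Fin n))}
    {K : Finset (Fin n)}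
    (hW : ∀ i ∈ K, ∀ A ∈ H, ∀ B ∈ H, A ⊆ K.erase i → B ⊆ K.erase i → A ∈ W → B ∈ W)
    {z : GenIndex.{u} H →₀ MvPolynomial (Fin n) k}
    (hz : z ∈ maxIdeal k n • LinearMap.ker (augmentation k H)) :
    coeff (chi K) (partialAugmentation k H W z) = 0 := by
  induction hz using Submodule.smul_induction_on' with
  | add x _ y _ hx hy => rw [map_add, coeff_add, hx, hy, add_zero]
  | smul r hr y hy =>
    induction hr using Submodule.span_induction generalizing y with
    | zero => simp
    | add r s _ _ hr hs => rw [add_smul, map_add, coeff_add, hr y hy, hs y hy, add_zero]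
    | smul a r _ hr =>
      -- The scalar `a` is absorbed into the kernel element, which is why `y` is generalized in the
      -- induction.
      rw [smul_assoc, smul_comm]
      exact hr _ (Submodule.smul_mem _ _ hy)
    | mem r hr =>
      obtain ⟨i, rfl⟩ := hr
      rw [map_smul, smul_eq_mul, coeff_X_mul']
      split_ifs with hi
      · have hiK : i ∈ K := by simpa [chi_apply] using hi
        have hc : chi K - Finsupp.single i 1 = chi (K.erase i) := by
          rw [chi, ← Finset.add_sum_erase K _ hiK, add_tsub_cancel_left, chi]
        rw [hc]
        exact coeff_partialAugmentation_eq_zero (hW i hiK) hy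
      · rfl

theorem linked_of_isLinearlyPresented {H : Set (Finset (Fin n))} (hH : ∀ A ∈ H, A.card = 3)
    (h : IsLinearlyPresented (Ideal.span ((fun A : Finset (Fin n) =>
      ∏ i ∈ A, (X i : MvPolynomial (Fin n) k)) '' H)) 3) (K : Finset (Fin n)) : Linked H K := by
  induction K using Finset.strongInduction with
  | H K ih =>
  intro A hA B hB hAK hBK
  by_cases hK : K.card ≤ 4
  · exact path_of_card_union_le_four hH hA hB hAK hBK hK
  by_contra hcon
  have hsub : ∀ C ⊆ K, chi (K \ C) + chi C = chi K := fun C hC => by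
    rw [chi, chi, chi, Finset.sum_sdiff hC]
  have hhom : ∀ C : GenIndex.{u} H, C.down.1 ⊆ K → IsHomogeneousVec (fun _ => 3) K.card
      (Finsupp.single C (monomial (chi (K \ C.down.1)) (1 : k))) := fun C hC => by
    have := isHomogeneousVec_single_monomial (k := k) (fun _ => 3) C (chi (K \ C.down.1)) 1
    have hcard := Finset.card_sdiff_add_card_eq_card hC
    rw [hH _ C.down.2] at hcard
    rwa [degree_chi, hcard] at this
  have hz := mem_maxIdeal_smul_ker hH h (z := Finsupp.single ⟨A, hA⟩ (monomial (chi (K \ A)) 1) -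
    Finsupp.single ⟨B, hB⟩ (monomial (chi (K \ B)) 1)) (e := K.card) (by omega)
    (by rw [sub_eq_add_neg]; exact (hhom ⟨A, hA⟩ hAK).add (hhom ⟨B, hB⟩ hBK).neg)
    (by rw [map_sub, augmentation_single, augmentation_single, monomial_mul, monomial_mul,
      hsub A hAK, hsub B hBK, sub_self])
  -- Take `W` to be the component of `A` inside `K`. By induction each `K.erase i` is linked, so its
  -- triples lie all inside or all outside `W`; but `A ∈ W` and `B ∉ W` make the coefficient 1.
  have h0 := coeff_partialAugmentation_eq_zero_of_mem_smul
    (W := {C | Relation.ReflTransGen (Step H K) A C}) (fun i hi C hC D hD hCK hDK hCW =>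
      Relation.ReflTransGen.trans hCW
        (path_mono (K.erase_subset i) (ih _ (Finset.erase_ssubset hi) C hC D hD hCK hDK))) hz
  rw [map_sub, coeff_sub, partialAugmentation, Finsupp.linearCombination_single,
    Finsupp.linearCombination_single,
    if_pos (show A ∈ {C | Relation.ReflTransGen (Step H K) A C} from .refl),
    if_neg (show ¬ B ∈ {C | Relation.ReflTransGen (Step H K) A C} from hcon),
    smul_eq_mul, monomial_mul, hsub A hAK] at h0
  simp at h0

end Necessity

/-! ### Translation of restrictions, dual graphs and patterns into families of triples. -/

section Restriction

variable {k : Type u} [Field k] {σ : Type*}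

theorem support_chi (A : Finset σ) : (chi A).support = A := by
  classical
  ext i
  simp [chi_apply]

/-- The minimal monomial generators of an ideal generated by square-free monomials of the same
degree. -/
theorem minGens_span {H : Set (Finset σ)} {d : ℕ} (hH : ∀ A ∈ H, A.card = d) :
    minGens (Ideal.span ((fun A : Finset σ => ∏ i ∈ A, (X i : MvPolynomial σ k)) '' H)) =
      chi '' H := by
  have hmem : ∀ b : σ →₀ ℕ, monomial b (1 : k) ∈
      Ideal.span ((fun A : Finset σ => ∏ i ∈ A, (X i : MvPolynomial σ k)) '' H) ↔
        ∃ A ∈ H, chi A ≤ b := by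
    intro b
    have := mem_ideal_span_monomial_image (R := k) (x := monomial b 1) (s := chi '' H)
    rw [Set.image_image] at this
    simp only [monomial_chi] at this
    rw [this]
    classical
    simp [support_monomial]
  ext a
  simp only [minGens, hmem, Set.mem_ofPred_eq, Set.mem_image]
  constructor
  · rintro ⟨⟨A, hA, hAa⟩, hmin⟩
    exact ⟨A, hA, hAa.antisymm (hmin ⟨A, hA, le_rfl⟩ hAa)⟩
  · rintro ⟨A, hA, rfl⟩
    refine ⟨⟨A, hA, le_rfl⟩, ?_⟩
    rintro b ⟨B, hB, hBb⟩ hbA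
    have := Finset.eq_of_subset_of_card_le (chi_le_chi.1 (hBb.trans hbA)) (by rw [hH A hA, hH B hB])
    rwa [this] at hBb

/-- The members of `H` contained in `K`, as subsets of `K`. -/
def restrictFamily (H : Set (Finset σ)) (K : Finset σ) : Set (Finset K) :=
  {A | A.map (Function.Embedding.subtype _) ∈ H}

theorem map_subtype_subset {K : Finset σ} (A : Finset K) :
    A.map (Function.Embedding.subtype _) ⊆ K := fun x hx => by
  obtain ⟨y, _, rfl⟩ := Finset.mem_map.1 hx
  exact y.2

theorem exists_map_subtype_eq {A K : Finset σ} (h : A ⊆ K) :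
    ∃ A' : Finset K, A'.map (Function.Embedding.subtype _) = A := by
  classical
  exact ⟨A.subtype (· ∈ K), Finset.subtype_map_of_mem h⟩

theorem card_of_mem_restrictFamily {H : Set (Finset σ)} {K : Finset σ} {d : ℕ}
    (hH : ∀ A ∈ H, A.card = d) {A : Finset K} (hA : A ∈ restrictFamily H K) : A.card = d := by
  rw [← hH _ hA, Finset.card_map]

theorem restriction_span (H : Set (Finset σ)) (K : Finset σ) :
    restriction (Ideal.span ((fun A : Finset σ => ∏ i ∈ A, (X i : MvPolynomial σ k)) '' H)) K =
      Ideal.span ((fun A : Finset K => ∏ i ∈ A, (X i : MvPolynomial K k)) ''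
        restrictFamily H K) := by
  classical
  rw [restriction, Ideal.map_span, Set.image_image]
  have hmap : ∀ A : Finset K, aeval (R := k) (fun i : σ => if h : i ∈ K then
      (X ⟨i, h⟩ : MvPolynomial K k) else 0) (∏ i ∈ A.map (Function.Embedding.subtype _), X i) =
        ∏ i ∈ A, X i := by
    intro A
    simp [map_prod]
  apply le_antisymm <;> rw [Ideal.span_le]
  · rintro _ ⟨A, hA, rfl⟩
    by_cases hAK : A ⊆ K
    · obtain ⟨A, rfl⟩ := exists_map_subtype_eq hAK
      exact Ideal.subset_span ⟨A, hA, (hmap A).symm⟩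
    · obtain ⟨i, hiA, hiK⟩ := Finset.not_subset.1 hAK
      have : ∏ i ∈ A, (if h : i ∈ K then (X ⟨i, h⟩ : MvPolynomial K k) else 0) = 0 :=
        Finset.prod_eq_zero hiA (dif_neg hiK)
      simp [map_prod, this]
  · rintro _ ⟨A, hA, rfl⟩
    exact Ideal.subset_span ⟨_, hA, hmap A⟩

theorem isSubsetUpToRelabeling_restriction_iff {H : Set (Finset σ)} {d : ℕ}
    (hH : ∀ A ∈ H, A.card = d) {K : Finset σ} {P : Set (Fin 6 →₀ ℕ)} :
    IsSubsetUpToRelabeling (restriction (Ideal.span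
      ((fun A : Finset σ => ∏ i ∈ A, (X i : MvPolynomial σ k)) '' H)) K) P ↔
      ∃ e : K ↪ Fin 6, ∀ A ∈ restrictFamily H K, chi (A.map e) ∈ P := by
  rw [restriction_span, IsSubsetUpToRelabeling,
    minGens_span fun A hA => card_of_mem_restrictFamily hH hA]
  simp only [Set.image_image, mapDomain_chi, Set.image_subset_iff]
  rfl

variable [DecidableEq σ]

/-- Taking supports identifies the vertices of the dual graph with the triples of `H` inside `K`,
and adjacency with meeting in exactly two elements. `Step` also allows equal triples, which does not
affect reachability. -/
theorem isDisconnected_restriction_iff {H : Set (Finset σ)} (hH : ∀ A ∈ H, A.card = 3)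
    (K : Finset σ) :
    IsDisconnected (restriction (Ideal.span
      ((fun A : Finset σ => ∏ i ∈ A, (X i : MvPolynomial σ k)) '' H)) K) ↔ ¬ Linked H K := by
  rw [restriction_span, IsDisconnected, not_iff_not]
  set J := Ideal.span ((fun A : Finset K => ∏ i ∈ A, (X i : MvPolynomial K k)) ''
    restrictFamily H K)
  have hJ : minGens J = chi '' restrictFamily H K :=
    minGens_span fun A hA => card_of_mem_restrictFamily hH hA
  let f : minGens J → Finset σ := fun v => v.1.support.map (Function.Embedding.subtype _)
  have hf : ∀ v, f v ∈ H ∧ v.1 = chi v.1.support := by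
    intro v
    obtain ⟨A, hA, hAv⟩ : v.1 ∈ chi '' restrictFamily H K := hJ.subset v.2
    simp only [f, ← hAv, support_chi]
    exact ⟨hA, trivial⟩
  have hfinj : Function.Injective f := fun v w hvw => by
    refine Subtype.ext ?_
    rw [(hf v).2, (hf w).2, Finset.map_injective _ hvw]
  have hfsurj : ∀ A ∈ H, A ⊆ K → ∃ v, f v = A := by
    intro A hA hAK
    obtain ⟨A, rfl⟩ := exists_map_subtype_eq hAK
    exact ⟨⟨chi A, hJ.symm.subset ⟨A, hA, rfl⟩⟩, by simp only [f, support_chi]⟩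
  have hadj : ∀ v w, (dualGraph J).Adj v w ↔ (f v ∩ f w).card = 2 := by
    intro v w
    have hdeg : ∀ v : minGens J, v.1.degree = 3 := fun v => by
      rw [(hf v).2, degree_chi, ← hH _ (hf v).1, Finset.card_map]
    have : (v.1 ⊓ w.1).degree = (f v ∩ f w).card := by
      rw [(hf v).2, (hf w).2, chi_inf, degree_chi, ← Finset.map_inter, Finset.card_map]
    simp only [dualGraph, hdeg, this]
    omega
  have hstep : ∀ v w, Step H K (f v) (f w) → (dualGraph J).Reachable v w := by
    intro v w h
    by_cases hvw : v = w
    · exact hvw ▸ .rfl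
    refine SimpleGraph.Adj.reachable ((hadj v w).2 ?_)
    have h2 := h.2.2.2.2
    have h3 : (f v ∩ f w).card ≠ 3 := by
      intro h3
      have e1 := Finset.eq_of_subset_of_card_le (Finset.inter_subset_left (s₁ := f v) (s₂ := f w))
        (by rw [h3, hH _ (hf v).1])
      have e2 := Finset.eq_of_subset_of_card_le (Finset.inter_subset_right (s₁ := f v) (s₂ := f w))
        (by rw [h3, hH _ (hf w).1])
      exact hvw (hfinj (e1.symm.trans e2))
    have h4 : (f v ∩ f w).card ≤ 3 := hH _ (hf v).1 ▸ Finset.card_le_card Finset.inter_subset_left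
    omega
  constructor
  · intro h A hA B hB hAK hBK
    obtain ⟨v, rfl⟩ := hfsurj A hA hAK
    obtain ⟨w, rfl⟩ := hfsurj B hB hBK
    refine Relation.ReflTransGen.lift f (fun a b hab => ?_)
      _ _ ((SimpleGraph.reachable_iff_reflTransGen v w).1 (h v w))
    exact ⟨(hf a).1, (hf b).1, map_subtype_subset _, map_subtype_subset _, ((hadj a b).1 hab).ge⟩
  · intro h v w
    have hpath := h (f v) (hf v).1 (f w) (hf w).1 (map_subtype_subset _) (map_subtype_subset _)
    generalize hC : f w = C at hpath
    induction hpath generalizing w with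
    | refl => exact hfinj hC ▸ .rfl
    | tail _ hs ih =>
      obtain ⟨u, hu⟩ := hfsurj _ hs.1 hs.2.2.1
      exact (ih u hu).trans (hstep u w (by rwa [hu, hC]))

/-- A finite set split into two parts embeds with prescribed images of the parts. -/
theorem exists_embedding_map_eq {τ ρ : Type*} [Fintype τ] [DecidableEq τ] {A : Finset τ}
    {C D : Finset ρ} (hCD : Disjoint C D) (hA : A.card = C.card) (hA' : Aᶜ.card = D.card) :
    ∃ e : τ ↪ ρ, A.map e = C ∧ Aᶜ.map e = D := by
  classical
  let a := Finset.equivOfCardEq hA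
  let b := Finset.equivOfCardEq hA'
  let g : τ → ρ := fun x =>
    if h : x ∈ A then (a ⟨x, h⟩).1 else (b ⟨x, Finset.mem_compl.2 h⟩).1
  have hgA : ∀ x ∈ A, g x ∈ C := fun x hx => by simp [g, hx]
  have hgA' : ∀ x ∉ A, g x ∈ D := fun x hx => by simp [g, hx]
  have hg : Function.Injective g := by
    intro x y hxy
    by_cases hx : x ∈ A <;> by_cases hy : y ∈ A
    · simpa [g, hx, hy, Subtype.ext_iff] using hxy
    · exact absurd (hxy ▸ hgA x hx) (fun h => Finset.disjoint_left.1 hCD h (hgA' y hy))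
    · exact absurd (hxy ▸ hgA' x hx) (Finset.disjoint_left.1 hCD (hgA y hy))
    · simpa [g, hx, hy, Subtype.ext_iff] using hxy
  refine ⟨⟨g, hg⟩, ?_, ?_⟩
  · refine Finset.eq_of_subset_of_card_le (fun y hy => ?_) (by rw [Finset.card_map, hA])
    obtain ⟨x, hx, rfl⟩ := Finset.mem_map.1 hy
    exact hgA x hx
  · refine Finset.eq_of_subset_of_card_le (fun y hy => ?_) (by rw [Finset.card_map, hA'])
    obtain ⟨x, hx, rfl⟩ := Finset.mem_map.1 hy
    exact hgA' x (Finset.mem_compl.1 hx)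

theorem isSubsetUpToRelabeling_patternTwo {H : Set (Finset σ)} (hH : ∀ A ∈ H, A.card = 3)
    {K A : Finset σ} (hK : K.card = 5) (hA : A ∈ H) (hAK : A ⊆ K)
    (hT : ∀ T ∈ H, T ⊆ K → T ≠ A → K \ A ⊆ T) :
    IsSubsetUpToRelabeling (restriction (Ideal.span
      ((fun A : Finset σ => ∏ i ∈ A, (X i : MvPolynomial σ k)) '' H)) K) patternTwo := by
  rw [isSubsetUpToRelabeling_restriction_iff hH]
  obtain ⟨A, rfl⟩ := exists_map_subtype_eq hAK
  have hcA : A.card = 3 := card_of_mem_restrictFamily hH hA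
  -- The exceptional triple goes to `x₃x₄x₅` and its complement to `x₁x₂`; any other triple is this
  -- pair with one more vertex.
  obtain ⟨e, he, he'⟩ := exists_embedding_map_eq (A := A) (C := {2, 3, 4})
    (D := ({0, 1} : Finset (Fin 6)))
    (by decide) (by rw [hcA]; rfl) (by rw [Finset.card_compl, Fintype.card_coe, hK, hcA]; rfl)
  refine ⟨e, fun T hTH => ?_⟩
  by_cases hTA : T = A
  · rw [hTA, he]
    simp [patternTwo, sqfree_eq_chi]
  have hsub : Aᶜ ⊆ T := by
    intro x hx
    have : x.1 ∈ _ := hT _ hTH (map_subtype_subset T) (fun h => hTA (Finset.map_injective _ h))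
      (Finset.mem_sdiff.2 ⟨x.2, by simpa using hx⟩)
    simpa using this
  have h1 : {0, 1} ⊆ T.map e := he' ▸ Finset.map_subset_map.2 hsub
  have h2 : T.map e ⊆ {2, 3, 4} ∪ {0, 1} := by
    rw [← he, ← he', ← Finset.map_union, Finset.union_compl]
    exact Finset.map_subset_map.2 (Finset.subset_univ _)
  have h3 : (T.map e).card = 3 := by
    rw [Finset.card_map, card_of_mem_restrictFamily hH hTH]
  have key : ∀ U : Finset (Fin 6), {0, 1} ⊆ U → U ⊆ {2, 3, 4} ∪ {0, 1} → U.card = 3 →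
      U = {0, 1, 2} ∨ U = {0, 1, 3} ∨ U = {0, 1, 4} := by decide
  obtain h | h | h := key _ h1 h2 h3 <;> rw [h] <;> simp [patternTwo, sqfree_eq_chi]

theorem isSubsetUpToRelabeling_patternOne {H : Set (Finset σ)} (hH : ∀ A ∈ H, A.card = 3)
    {K A B : Finset σ} (hK : K.card = 6) (hA : A ∈ H) (hAB : A ∪ B = K)
    (hT : ∀ T ∈ H, T ⊆ K → T = A ∨ T = B) :
    IsSubsetUpToRelabeling (restriction (Ideal.span
      ((fun A : Finset σ => ∏ i ∈ A, (X i : MvPolynomial σ k)) '' H)) K) patternOne := by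
  rw [isSubsetUpToRelabeling_restriction_iff hH]
  obtain ⟨A', hA'⟩ := exists_map_subtype_eq (hAB ▸ Finset.subset_union_left : A ⊆ K)
  have hcA : A'.card = 3 := by rw [← hH A hA, ← hA', Finset.card_map]
  obtain ⟨e, he, he'⟩ := exists_embedding_map_eq (A := A') (C := {0, 1, 2})
    (D := ({3, 4, 5} : Finset (Fin 6))) (by decide) (by rw [hcA]; rfl)
    (by rw [Finset.card_compl, Fintype.card_coe, hK, hcA]; rfl)
  refine ⟨e, fun T hTH => ?_⟩
  obtain h | h := hT _ hTH (map_subtype_subset T)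
  · obtain rfl : T = A' := Finset.map_injective _ (h.trans hA'.symm)
    rw [he]
    simp [patternOne, sqfree_eq_chi]
  · have hcompl : T = A'ᶜ := by
      refine (Finset.eq_of_subset_of_card_le (fun x hx => ?_) ?_).symm
      · have hxA : x.1 ∉ A := by
          rw [← hA']
          simpa using hx
        have hxB : x.1 ∈ B := (Finset.mem_union.1 (hAB ▸ x.2)).resolve_left hxA
        rw [← h] at hxB
        simpa using hxB
      · rw [Finset.card_compl, Fintype.card_coe, hK, hcA, card_of_mem_restrictFamily hH hTH]
    rw [hcompl, he']
    simp [patternOne, sqfree_eq_chi]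

end Restriction

end CubicLinear

end

theorem theorem2p3 {k : Type*} [Field k] {n : ℕ} (I : Ideal (MvPolynomial (Fin n) k))
    (hI : CubicLinear.IsSquarefreeMonomialIdeal I 3) :
    CubicLinear.IsLinearlyPresented I 3 ↔
      ∀ K : Finset (Fin n), K.card ≤ 6 →
        ¬ (CubicLinear.IsDisconnected (CubicLinear.restriction I K) ∧
          (CubicLinear.IsSubsetUpToRelabeling (CubicLinear.restriction I K)
              CubicLinear.patternOne ∨
            CubicLinear.IsSubsetUpToRelabeling (CubicLinear.restriction I K)
              CubicLinear.patternTwo)) := by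
  obtain ⟨H, hH, rfl⟩ := hI
  constructor
  · rintro h K - ⟨hdis, -⟩
    exact (CubicLinear.isDisconnected_restriction_iff hH K).1 hdis
      (CubicLinear.linked_of_isLinearlyPresented hH h K)
  · intro h
    refine CubicLinear.isLinearlyPresented_of_path hH fun A hA B hB =>
      CubicLinear.path_of_no_obstruction hH (fun K hK A hA hAK hT => ?_)
        (fun A hA B hB hK hT => ?_) hA hB
    · by_contra hL
      exact h K (by omega) ⟨(CubicLinear.isDisconnected_restriction_iff hH K).2 hL,
        Or.inr (CubicLinear.isSubsetUpToRelabeling_patternTwo hH hK hA hAK hT)⟩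
    · by_contra hL
      exact h (A ∪ B) hK.le ⟨(CubicLinear.isDisconnected_restriction_iff hH _).2 hL,
        Or.inl (CubicLinear.isSubsetUpToRelabeling_patternOne hH hK hA rfl hT)⟩
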